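/- Let $\Sigma$ be a compact connected Riemann surface and $L\to\Sigma$ a holomorphic line bundle with $h^0(\Sigma,L)\neq 0$. A Higgs bundle is a pair $(E,\phi)$ of a holomorphic vector bundle $E$ on $\Sigma$ and a holomorphic bundle map $\phi:E\to E\otimes L$ (the Higgs field). Its Higgs Harder–Narasimhan filtration is the unique filtration $0=E^0\subset E^1\subset\cdots\subset E^s=E$ by $\phi$-invariant holomorphic subbundles whose successive quotients, with the induced Higgs fields, are semistable Higgs bundles of strictly decreasing slopes $d_1/r_1>\cdots>d_s/r_s$, where $d_i=\deg(E^i/E^{i-1})$ and $r_i=\operatorname{rk}(E^i/E^{i-1})$; its type is the vector $\mu=(d_1/r_1,\dots,d_1/r_1,\,d_2/r_2,\dots,d_s/r_s)$ in which $d_i/r_i$ appears $r_i$ times. Put $$\operatorname{End}_{-1}(E,\phi)=\{\psi\in\operatorname{End}(E)\mid (\psi\otimes\operatorname{id}_L)\circ\phi=\phi\circ\psi,\ \psi(E^i)\subseteq E^{i-1}\text{ for } i=1,\dots,s\}.$$ The Harder–Narasimhan filtration and type of a vector bundle are defined in the same way, without Higgs fields. Write $\mu_0=(d/r,\dots,d/r)$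 for the type of a semistable bundle of rank $r$ and degree $d$. Let $E$ be a holomorphic vector bundle on $\Sigma$ of rank $r$ and degree $d$ whose Harder–Narasimhan type $\mu$ is different from $\mu_0$ and whose Harder–Narasimhan filtration splits: $E=E_1\oplus\cdots\oplus E_s$ with holomorphic subbundles $E_i$ such that $E^k=E_1\oplus\cdots\oplus E_k$, $0\le k\le s$, is the Harder–Narasimhan filtration of $E$. Then there are pairwise distinct sections $\sigma_1,\dots,\sigma_s\in H^0(\Sigma,L)$ such that the Higgs field $\phi:E\to E\otimes L$ given by $\phi(v)=v\otimes\sigma_i$ for $v\in E_i$ has the following properties: the Higgs Harder–Narasimhan filtration of $(E,\phi)$ is the filtration $(E^k)$, so that $(E,\phi)$ has Higgs Harder–Narasimhan type $\mu$; and $$\operatorname{End}_{-1}(E,\phi)=\{0\}.$$ In particular, for such a $\mu$ there are Higgs bundles of Higgs Harder–Narasimhan type $\mu$ with $\dim\operatorname{End}_{-1}=0$. -/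

import Mathlib

open Bundle Topology
open scoped Manifold ContDiff TensorProduct

noncomputable section

namespace HiggsBundle

section Sections

variable {X : Type*} [TopologicalSpace X] [ChartedSpace ℂ X]
  (F : Type*) [NormedAddCommGroup F] [NormedSpace ℂ F]
  {E : X → Type*} [TopologicalSpace (TotalSpace F E)]
  [∀ x, AddCommGroup (E x)] [∀ x, Module ℂ (E x)] [∀ x, TopologicalSpace (E x)]
  [FiberBundle F E] [VectorBundle ℂ F E]

/-- The section `s` of the bundle `E` (with model fibre `F`) is holomorphic on the set `U`. -/
def IsHolOn (s : ∀ x, E x) (U : Set X) : Prop :=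
  ContMDiffOn 𝓘(ℂ) (𝓘(ℂ).prod 𝓘(ℂ, F)) ω (fun x => TotalSpace.mk' F x (s x)) U

variable (E) in
/-- A holomorphic subbundle (of constant rank) of the holomorphic vector bundle `E`: a family of
linear subspaces of the fibres which is spanned, locally, by `rank` holomorphic sections of `E`
that are linearly independent at every point. -/
structure Subbundle where
  fiber : ∀ x, Submodule ℂ (E x)
  rank : ℕ
  exists_frame : ∀ x₀ : X, ∃ U : Set X, IsOpen U ∧ x₀ ∈ U ∧ ∃ b : Fin rank → ∀ x, E x,
    (∀ i, IsHolOn F (b i) U) ∧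
      ∀ x ∈ U, LinearIndependent ℂ (fun i => b i x) ∧
        Submodule.span ℂ (Set.range fun i => b i x) = fiber x

namespace Subbundle

variable (E) in
/-- The zero subbundle. -/
def zero : Subbundle F E where
  fiber _ := ⊥
  rank := 0
  exists_frame x₀ := ⟨Set.univ, isOpen_univ, Set.mem_univ x₀, fun i => i.elim0,
    fun i => i.elim0, fun x _ => ⟨linearIndependent_empty_type, by
      simp [Set.range_eq_empty]⟩⟩

variable (E) in
/-- The whole bundle `E`, as a subbundle of itself. -/
def whole [FiniteDimensional ℂ F] [ContMDiffVectorBundle ω F E 𝓘(ℂ)] : Subbundle F E where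
  fiber _ := ⊤
  rank := Module.finrank ℂ F
  exists_frame x₀ := by
    let e := trivializationAt F E x₀
    have h := e.isLocalFrameOn_localFrame_baseSet 𝓘(ℂ) ω (Module.finBasis ℂ F)
    exact ⟨e.baseSet, e.open_baseSet, FiberBundle.mem_baseSet_trivializationAt F E x₀,
      e.localFrame (Module.finBasis ℂ F), fun i => h.contMDiffOn i,
      fun x hx => ⟨h.linearIndependent hx, top_le_iff.1 (h.generating hx)⟩⟩

variable {F}

/-- Inclusion of subbundles. -/
instance : LE (Subbundle F E) := ⟨fun A B => ∀ x, A.fiber x ≤ B.fiber x⟩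

/-! For subbundles `A ≤ B` of `E`, the quotient bundle `B / A` is treated through the pair
`(A, B)`: its fibres are the images of `B x` in `E x ⧸ A x`, its local holomorphic sections are
locally the classes of holomorphic sections of `B`, and its holomorphic subbundles are the
quotients `C / A` of the subbundles `C` of `E` with `A ≤ C ≤ B`. -/

/-- The holomorphic sections `b i` of `B` over `U` induce a holomorphic frame of `B / A`
over `U`. -/
def IsQuotientFrame (A B : Subbundle F E) {r : ℕ} (b : Fin r → ∀ x, E x) (U : Set X) : Prop :=
  (∀ i, IsHolOn F (b i) U) ∧
    ∀ x ∈ U, LinearIndependent ℂ (fun i => (A.fiber x).mkQ (b i x)) ∧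
      Submodule.span ℂ (Set.range fun i => (A.fiber x).mkQ (b i x)) =
        (B.fiber x).map (A.fiber x).mkQ

/-- The quotient bundle `B / A` has degree `d`: there are `r = rk (B / A)` meromorphic sections
`t 0, …, t (r - 1)` of `B / A` such that the nonzero meromorphic section `t 0 ∧ ⋯ ∧ t (r - 1)` of
the determinant line bundle `det (B / A)` has a divisor `D` of degree `d`. Near every point `x₀`
the sections are written as `t j = ∑ i, c i j • [b i]` in a local holomorphic frame
of `B / A`, with meromorphic coefficients, and the order of `t 0 ∧ ⋯ ∧ t (r - 1)` at `x₀` is the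
order of `det c`. The values of the `t j` at their poles are irrelevant. -/
def HasDegree (A B : Subbundle F E) (d : ℤ) : Prop :=
  ∃ (t : Fin (B.rank - A.rank) → ∀ x, E x ⧸ A.fiber x) (D : X →₀ ℤ),
    (D.sum fun _ n => n) = d ∧
    ∀ x₀ : X, ∃ (U : Set X) (b : Fin (B.rank - A.rank) → ∀ x, E x)
      (c : X → Matrix (Fin (B.rank - A.rank)) (Fin (B.rank - A.rank)) ℂ),
      IsOpen U ∧ x₀ ∈ U ∧ IsQuotientFrame A B b U ∧
      (∀ i j, MeromorphicAt (fun z => c ((chartAt ℂ x₀).symm z) i j) (chartAt ℂ x₀ x₀)) ∧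
      (∀ᶠ x in 𝓝[≠] x₀, ∀ j, t j x = ∑ i, c x i j • (A.fiber x).mkQ (b i x)) ∧
      meromorphicOrderAt (fun z => (c ((chartAt ℂ x₀).symm z)).det) (chartAt ℂ x₀ x₀) = D x₀

/-- The degree of the quotient bundle `B / A` (over a compact Riemann surface every holomorphic
vector bundle has exactly one degree). -/
def degree (A B : Subbundle F E) : ℤ := Classical.epsilon (HasDegree A B)

/-- The slope `deg (B / A) / rk (B / A)`. -/
def slope (A B : Subbundle F E) : ℚ := (degree A B : ℚ) / ((B.rank : ℚ) - (A.rank : ℚ))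

/-- The quotient bundle `B / A` is a semistable vector bundle: `μ(C / A) ≤ μ(B / A)` for every
nonzero holomorphic subbundle `C / A` of it. -/
def IsSemistable (A B : Subbundle F E) : Prop :=
  ∀ C : Subbundle F E, A ≤ C → C ≤ B → A.rank < C.rank → slope A C ≤ slope A B

/-- `0 = E⁰ ⊂ E¹ ⊂ ⋯ ⊂ Eˢ = E` is the Harder-Narasimhan filtration of `E`. -/
structure IsHNFiltration [FiniteDimensional ℂ F] [ContMDiffVectorBundle ω F E 𝓘(ℂ)] {s : ℕ}
    (Fil : Fin (s + 1) → Subbundle F E) : Prop where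
  first : Fil 0 = zero F E
  last : Fil (Fin.last s) = whole F E
  le : ∀ i : Fin s, Fil i.castSucc ≤ Fil i.succ
  rank_lt : ∀ i : Fin s, (Fil i.castSucc).rank < (Fil i.succ).rank
  semistable : ∀ i : Fin s, IsSemistable (Fil i.castSucc) (Fil i.succ)
  slope_lt : ∀ i j : Fin s, i < j →
    slope (Fil j.castSucc) (Fil j.succ) < slope (Fil i.castSucc) (Fil i.succ)

/-- The type of a filtration: the vector `(d₁/r₁, …, d₁/r₁, d₂/r₂, …, dₛ/rₛ)` in which the slope
`dᵢ/rᵢ` of the `i`-th successive quotient appears `rᵢ` times, `rᵢ` being its rank. -/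
def filtrationType {s : ℕ} (Fil : Fin (s + 1) → Subbundle F E) : List ℚ :=
  (List.ofFn fun i : Fin s => List.replicate ((Fil i.succ).rank - (Fil i.castSucc).rank)
    (slope (Fil i.castSucc) (Fil i.succ))).flatten

variable (F E) in
/-- The type `(d/r, …, d/r)` of a semistable (Higgs) bundle of the rank `r` and the degree `d`
of `E`. -/
def semistableType [FiniteDimensional ℂ F] [ContMDiffVectorBundle ω F E 𝓘(ℂ)] : List ℚ :=
  List.replicate (whole F E).rank (slope (zero F E) (whole F E))

end Subbundle

variable (E) in
/-- A family of linear endomorphisms of the fibres of `E` is a holomorphic endomorphism of `E`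
when it maps local holomorphic sections to local holomorphic sections. -/
def IsHolEnd (ψ : ∀ x, E x →ₗ[ℂ] E x) : Prop :=
  ∀ (U : Set X) (s : ∀ x, E x), IsOpen U → IsHolOn F s U → IsHolOn F (fun x => ψ x (s x)) U

end Sections

section Higgs

variable {X : Type*} [TopologicalSpace X] [ChartedSpace ℂ X]
  (F : Type*) [NormedAddCommGroup F] [NormedSpace ℂ F]
  (E : X → Type*) [TopologicalSpace (TotalSpace F E)]
  [∀ x, AddCommGroup (E x)] [∀ x, Module ℂ (E x)] [∀ x, TopologicalSpace (E x)]
  [FiberBundle F E] [VectorBundle ℂ F E]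
  (L : X → Type*) [TopologicalSpace (TotalSpace ℂ L)]
  [∀ x, AddCommGroup (L x)] [∀ x, Module ℂ (L x)] [∀ x, TopologicalSpace (L x)]
  [FiberBundle ℂ L] [VectorBundle ℂ ℂ L]

variable {E L} in
/-- The section `t` of `E ⊗ L` is holomorphic on `U`: locally it is a finite sum of tensors
`e ⊗ l` of holomorphic sections `e` of `E` and `l` of `L`. -/
def IsHolTensorOn (t : ∀ x, E x ⊗[ℂ] L x) (U : Set X) : Prop :=
  ∀ x₀ ∈ U, ∃ V ⊆ U, IsOpen V ∧ x₀ ∈ V ∧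
    ∃ (n : ℕ) (e : Fin n → ∀ x, E x) (l : Fin n → ∀ x, L x),
      (∀ k, IsHolOn F (e k) V) ∧ (∀ k, IsHolOn ℂ (l k) V) ∧
        ∀ x ∈ V, t x = ∑ k, e k x ⊗ₜ[ℂ] l k x

/-- An `L`-twisted Higgs field on `E`: a holomorphic bundle map `φ : E → E ⊗ L`. -/
structure HiggsField where
  toFun : ∀ x, E x →ₗ[ℂ] E x ⊗[ℂ] L x
  holomorphic : ∀ (U : Set X) (s : ∀ x, E x), IsOpen U → IsHolOn F s U →
    IsHolTensorOn F (fun x => toFun x (s x)) U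

variable {F E L}

namespace HiggsField

/-- The subbundle `C` is `φ`-invariant: `φ(C) ⊆ C ⊗ L`. -/
def IsInvariant (φ : HiggsField F E L) (C : Subbundle F E) : Prop :=
  ∀ x, ∀ v ∈ C.fiber x,
    φ.toFun x v ∈ LinearMap.range (LinearMap.rTensor (L x) (C.fiber x).subtype)

/-- For `φ`-invariant `A ≤ B`, the quotient bundle `B / A` with its induced Higgs field is a
semistable Higgs bundle: `μ(C / A) ≤ μ(B / A)` for every nonzero invariant subbundle `C / A`. -/
def IsSemistable (φ : HiggsField F E L) (A B : Subbundle F E) : Prop :=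
  ∀ C : Subbundle F E, A ≤ C → C ≤ B → A.rank < C.rank → φ.IsInvariant C →
    Subbundle.slope A C ≤ Subbundle.slope A B

/-- `0 = E⁰ ⊂ E¹ ⊂ ⋯ ⊂ Eˢ = E` is the Higgs Harder-Narasimhan filtration of `(E, φ)`. -/
structure IsHNFiltration [FiniteDimensional ℂ F] [ContMDiffVectorBundle ω F E 𝓘(ℂ)] {s : ℕ}
    (φ : HiggsField F E L) (Fil : Fin (s + 1) → Subbundle F E) : Prop where
  first : Fil 0 = Subbundle.zero F E
  last : Fil (Fin.last s) = Subbundle.whole F E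
  le : ∀ i : Fin s, Fil i.castSucc ≤ Fil i.succ
  rank_lt : ∀ i : Fin s, (Fil i.castSucc).rank < (Fil i.succ).rank
  invariant : ∀ i, φ.IsInvariant (Fil i)
  semistable : ∀ i : Fin s, φ.IsSemistable (Fil i.castSucc) (Fil i.succ)
  slope_lt : ∀ i j : Fin s, i < j →
    Subbundle.slope (Fil j.castSucc) (Fil j.succ) <
      Subbundle.slope (Fil i.castSucc) (Fil i.succ)

/-- The space `End(E, φ)` of endomorphisms of the Higgs bundle `(E, φ)`: the holomorphic
endomorphisms `ψ` of `E` with `(ψ ⊗ id) ∘ φ = φ ∘ ψ`. -/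
def endomorphisms (φ : HiggsField F E L) : Submodule ℂ (∀ x, E x →ₗ[ℂ] E x) where
  carrier := {ψ | IsHolEnd F E ψ ∧
    ∀ x, LinearMap.rTensor (L x) (ψ x) ∘ₗ φ.toFun x = φ.toFun x ∘ₗ ψ x}
  zero_mem' := ⟨fun _ _ _ _ => (contMDiff_zeroSection ℂ E).contMDiffOn, fun x => by simp⟩
  add_mem' ha hb := ⟨fun U s hU hs => (ha.1 U s hU hs).add_section (hb.1 U s hU hs), fun x => by
    simp only [Pi.add_apply, LinearMap.rTensor_add, LinearMap.add_comp, LinearMap.comp_add,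
      ha.2 x, hb.2 x]⟩
  smul_mem' a _ hψ := ⟨fun U s hU hs => (hψ.1 U s hU hs).const_smul_section (a := a), fun x => by
    simp only [Pi.smul_apply, LinearMap.rTensor_smul, LinearMap.smul_comp, LinearMap.comp_smul,
      hψ.2 x]⟩

/-- The space `End₋₁(E, φ) = {ψ ∈ End(E, φ) | ψ(Eⁱ) ⊆ Eⁱ⁻¹ for i = 1, …, s}`, where
`0 = E⁰ ⊂ E¹ ⊂ ⋯ ⊂ Eˢ = E` is the Higgs Harder-Narasimhan filtration of `(E, φ)`. -/
def endNegOne {s : ℕ} (φ : HiggsField F E L) (Fil : Fin (s + 1) → Subbundle F E) :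
    Submodule ℂ (∀ x, E x →ₗ[ℂ] E x) where
  carrier := {ψ | ψ ∈ φ.endomorphisms ∧
    ∀ (i : Fin s) (x : X), ∀ v ∈ (Fil i.succ).fiber x, ψ x v ∈ (Fil i.castSucc).fiber x}
  zero_mem' := ⟨Submodule.zero_mem _, fun _ _ _ _ => Submodule.zero_mem _⟩
  add_mem' ha hb := ⟨Submodule.add_mem _ ha.1 hb.1, fun i x v hv =>
    Submodule.add_mem _ (ha.2 i x v hv) (hb.2 i x v hv)⟩
  smul_mem' a _ hψ := ⟨Submodule.smul_mem _ a hψ.1, fun i x v hv =>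
    Submodule.smul_mem _ a (hψ.2 i x v hv)⟩

end HiggsField

end Higgs

end HiggsBundle

end

/-! Fix a nonzero `σ ∈ H⁰(L)` and distinct scalars `a i`, and let `σᵢ = a i • σ`. Then `φ = D ⊗ σ`,
where `D` is the endomorphism acting by `a i` on `Eᵢ`. Since `D` preserves every `Eᵏ`, the
filtration is `φ`-invariant. Higgs semistability tests only invariant subbundles, so the
Harder–Narasimhan filtration of `E` is also that of `(E, φ)`. Where `σ x ≠ 0`, an endomorphism `ψ`
of `(E, φ)` commutes with `D`, so it preserves each eigenspace of `D`; if it also lowers the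
filtration, it sends `Eᵢ` into a sum of other eigenspaces, and independence of eigenspaces forces `ψ
x = 0` (`eq_zero_of_commute_of_lowering`). By the identity theorem such points are dense
(`IsHolOn.dense_setOf_ne_zero`), and continuity gives `ψ = 0`. Holomorphy of `D` is seen in local
frames adapted to the splitting, where sections have holomorphic coefficients
(`IsLocalFrameOn.contMDiffOn_coeff`). -/

/-- The coefficients of a `C^n` section in a `C^n` local frame are `C^n`. -/
theorem IsLocalFrameOn.contMDiffOn_coeff {𝕜 : Type*} [NontriviallyNormedField 𝕜] [CompleteSpace 𝕜]
    {E : Type*} [NormedAddCommGroup E] [NormedSpace 𝕜 E]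
    {H : Type*} [TopologicalSpace H] {I : ModelWithCorners 𝕜 E H}
    {M : Type*} [TopologicalSpace M] [ChartedSpace H M]
    {F : Type*} [NormedAddCommGroup F] [NormedSpace 𝕜 F] [FiniteDimensional 𝕜 F]
    {V : M → Type*} [TopologicalSpace (TotalSpace F V)]
    [∀ x, AddCommGroup (V x)] [∀ x, Module 𝕜 (V x)] [∀ x, TopologicalSpace (V x)]
    [FiberBundle F V] [VectorBundle 𝕜 F V]
    {n : ℕ∞ω} [ContMDiffVectorBundle n F V I] {ι : Type*} [Fintype ι]
    {s : ι → (x : M) → V x} {u : Set M} (hs : IsLocalFrameOn I F n s u) (hu : IsOpen u)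
    {t : (x : M) → V x}
    (ht : ContMDiffOn I (I.prod 𝓘(𝕜, F)) n (fun x => TotalSpace.mk' F x (t x)) u) (i : ι) :
    ContMDiffOn I 𝓘(𝕜) n (fun x => hs.coeff i x (t x)) u := by
  intro x₀ hx₀
  let e := trivializationAt F V x₀
  have he₀ : x₀ ∈ e.baseSet := FiberBundle.mem_baseSet_trivializationAt F V x₀
  -- the matrix of the frame in the trivialization, as an operator `(ι → 𝕜) → F`
  let A : M → ((ι → 𝕜) →L[𝕜] F) := fun x =>
    ∑ j, (ContinuousLinearMap.smulRightL 𝕜 (ι → 𝕜) F (ContinuousLinearMap.proj j)) (e ⟨x, s j x⟩).2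
  have hA : ContMDiffAt I 𝓘(𝕜, (ι → 𝕜) →L[𝕜] F) n A x₀ := by
    refine ContMDiffAt.sum fun j _ => ?_
    have h1 := (contMDiffAt_section x₀).1 (hs.contMDiffAt hu hx₀ j)
    exact (ContinuousLinearMap.contMDiff _).contMDiffAt.comp x₀ h1
  have hT := (contMDiffAt_section x₀).1 (ht.contMDiffAt (hu.mem_nhds hx₀))
  have hequiv : ∀ x (hx : x ∈ u) (hxe : x ∈ e.baseSet),
      A x = ((((hs.toBasisAt hx).equivFun.symm ≪≫ₗ
        e.linearEquivAt 𝕜 x hxe).toContinuousLinearEquiv : (ι → 𝕜) ≃L[𝕜] F) :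
          (ι → 𝕜) →L[𝕜] F) := by
    intro x hx hxe
    ext1 c
    simp [A, Module.Basis.equivFun_symm_apply]
  -- `ContinuousLinearMap.inverse` is `C^n` at an invertible operator, and the frame coefficients of
  -- `t` are `(A x)⁻¹` applied to `t` read in the trivialization.
  have hinv : ContMDiffAt I 𝓘(𝕜, F →L[𝕜] (ι → 𝕜)) n
      (fun x => ContinuousLinearMap.inverse (A x)) x₀ := by
    have h := contDiffAt_map_inverse (n := n) (((hs.toBasisAt hx₀).equivFun.symm ≪≫ₗ
        e.linearEquivAt 𝕜 x₀ he₀).toContinuousLinearEquiv : (ι → 𝕜) ≃L[𝕜] F)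
    rw [← hequiv x₀ hx₀ he₀] at h
    exact h.contMDiffAt.comp x₀ hA
  have hc := (ContinuousLinearMap.contMDiff (n := n)
    (ContinuousLinearMap.proj (R := 𝕜) (φ := fun _ : ι => 𝕜) i)).contMDiffAt.comp x₀
      (hinv.clm_apply hT)
  refine (hc.congr_of_eventuallyEq ?_).contMDiffWithinAt
  filter_upwards [hu.mem_nhds hx₀, e.open_baseSet.mem_nhds he₀] with x hx hxe
  have h1 : (e ⟨x, t x⟩).2 = A x ((hs.toBasisAt hx).equivFun (t x)) := by
    rw [hequiv x hx hxe]
    change _ = e.linearEquivAt 𝕜 x hxe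
      ((hs.toBasisAt hx).equivFun.symm ((hs.toBasisAt hx).equivFun (t x)))
    rw [LinearEquiv.symm_apply_apply, Trivialization.linearEquivAt_apply]
  have h2 : ContinuousLinearMap.inverse (A x) (e ⟨x, t x⟩).2 =
      (hs.toBasisAt hx).equivFun (t x) := by
    rw [h1, hequiv x hx hxe, ContinuousLinearMap.inverse_equiv]
    exact ContinuousLinearEquiv.symm_apply_apply _ _
  change _ = (ContinuousLinearMap.inverse (A x) (e ⟨x, t x⟩).2) i
  rw [h2, hs.coeff_apply_of_mem hx, Module.Basis.equivFun_apply]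

namespace HiggsBundle

/-! ### Identity theorem and holomorphic splittings -/

section Holomorphic

set_option linter.unusedSectionVars false

variable {X : Type*} [TopologicalSpace X] [ChartedSpace ℂ X]
  {F : Type*} [NormedAddCommGroup F] [NormedSpace ℂ F]
  {E : X → Type*} [TopologicalSpace (TotalSpace F E)]
  [∀ x, AddCommGroup (E x)] [∀ x, Module ℂ (E x)] [∀ x, TopologicalSpace (E x)]
  [FiberBundle F E] [VectorBundle ℂ F E]

theorem trivialization_snd_eq_zero_iff (e : Trivialization F (TotalSpace.proj : TotalSpace F E → X))
    [MemTrivializationAtlas e] {x : X} (hx : x ∈ e.baseSet) (v : E x) :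
    (e ⟨x, v⟩).2 = 0 ↔ v = 0 := by
  rw [← Trivialization.linearEquivAt_apply (R := ℂ) e x hx, LinearEquiv.map_eq_zero_iff]

/-- A holomorphic section on a Riemann surface vanishes near a given point, or has no other zero
near that point. -/
theorem IsHolOn.eventually_eq_zero_or_eventually_ne_zero [ContMDiffVectorBundle ω F E 𝓘(ℂ)]
    {σ : ∀ x, E x} {U : Set X} (hσ : IsHolOn F σ U) {x₀ : X} (hU : U ∈ 𝓝 x₀) :
    (∀ᶠ x in 𝓝 x₀, σ x = 0) ∨ ∀ᶠ x in 𝓝[≠] x₀, σ x ≠ 0 := by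
  let e := trivializationAt F E x₀
  have hbase : ∀ᶠ x in 𝓝 x₀, x ∈ e.baseSet :=
    e.open_baseSet.mem_nhds (FiberBundle.mem_baseSet_trivializationAt F E x₀)
  have hsource : ∀ᶠ x in 𝓝 x₀, x ∈ (chartAt ℂ x₀).source :=
    (chartAt ℂ x₀).open_source.mem_nhds (mem_chart_source ℂ x₀)
  have hcont := (chartAt ℂ x₀).continuousAt (mem_chart_source ℂ x₀)
  have h := ((contMDiffAt_iff.1 ((contMDiffAt_section x₀).1 (hσ.contMDiffAt hU))).2)
  simp only [mfld_simps] at h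
  have hg : AnalyticAt ℂ ((fun x => (e ⟨x, σ x⟩).2) ∘ (chartAt ℂ x₀).symm) (chartAt ℂ x₀ x₀) :=
    (contDiffWithinAt_univ.1 h).analyticAt
  rcases hg.eventually_eq_zero_or_eventually_ne_zero with h0 | h0
  · left
    filter_upwards [hbase, hsource, hcont.eventually h0] with x hx hs h
    rw [Function.comp_apply, (chartAt ℂ x₀).left_inv hs] at h
    exact (trivialization_snd_eq_zero_iff e hx _).1 h
  · right
    rw [eventually_nhdsWithin_iff] at h0 ⊢
    filter_upwards [hbase, hsource, hcont.eventually h0] with x hx hs h hne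
    have h := h fun heq => hne ((chartAt ℂ x₀).injOn hs (mem_chart_source ℂ x₀) heq)
    rw [Function.comp_apply, (chartAt ℂ x₀).left_inv hs] at h
    exact fun h' => h ((trivialization_snd_eq_zero_iff e hx _).2 h')

/-- A nonzero holomorphic section over a connected Riemann surface is nonzero on a dense set. -/
theorem IsHolOn.dense_setOf_ne_zero [ConnectedSpace X] [ContMDiffVectorBundle ω F E 𝓘(ℂ)]
    {σ : ∀ x, E x} (hσ : IsHolOn F σ Set.univ) (hne : σ ≠ 0) : Dense {x | σ x ≠ 0} := by
  have hclopen : IsClopen (interior {x | σ x = 0}) := by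
    refine ⟨isClosed_of_closure_subset fun x₀ hx₀ => ?_, isOpen_interior⟩
    rcases hσ.eventually_eq_zero_or_eventually_ne_zero (x₀ := x₀) Filter.univ_mem with h | h
    · exact mem_interior_iff_mem_nhds.2 h
    -- The interior of the zero set accumulates at `x₀` without containing it, so zeros other than
    -- `x₀` occur arbitrarily near, against isolation.
    · by_contra hx₀'
      obtain ⟨x, hx, hxZ⟩ := ((mem_closure_iff_frequently.1 hx₀).and_eventually
        (eventually_nhdsWithin_iff.1 h)).exists
      exact hxZ (fun heq => hx₀' (heq ▸ hx)) (interior_subset (s := {x | σ x = 0}) hx)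
  rcases isClopen_iff.1 hclopen with h | h
  · exact interior_eq_empty_iff_dense_compl.1 h
  · exact absurd (funext fun x => interior_subset (s := {x | σ x = 0}) (h ▸ Set.mem_univ x)) hne

/-- A holomorphic endomorphism which vanishes on a dense set of fibres is zero. -/
theorem IsHolEnd.eq_zero_of_dense [FiniteDimensional ℂ F] [ContMDiffVectorBundle ω F E 𝓘(ℂ)]
    {ψ : ∀ x, E x →ₗ[ℂ] E x} (hψ : IsHolEnd F E ψ) {S : Set X} (hS : Dense S)
    (h0 : ∀ x ∈ S, ψ x = 0) : ψ = 0 := by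
  funext x₀
  let e := trivializationAt F E x₀
  have hx₀ : x₀ ∈ e.baseSet := FiberBundle.mem_baseSet_trivializationAt F E x₀
  have hfr := e.isLocalFrameOn_localFrame_baseSet 𝓘(ℂ) ω (Module.finBasis ℂ F)
  refine (hfr.toBasisAt hx₀).ext fun i => ?_
  rw [hfr.toBasisAt_coe]
  have hhol := hψ e.baseSet _ e.open_baseSet (hfr.contMDiffOn i)
  have hcont : ContinuousOn (fun x => (e ⟨x, ψ x (e.localFrame (Module.finBasis ℂ F) i x)⟩).2)
      e.baseSet := (e.contMDiffOn_section_baseSet_iff.1 hhol).continuousOn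
  refine (trivialization_snd_eq_zero_iff e hx₀ _).1 ?_
  -- Nonvanishing of the image of a frame section is an open condition, so it would also hold at
  -- some point of `S`.
  by_contra hne
  obtain ⟨x, ⟨hx, hxne⟩, hxS⟩ := hS.inter_open_nonempty _
    (hcont.isOpen_inter_preimage e.open_baseSet isOpen_compl_singleton) ⟨x₀, hx₀, hne⟩
  exact hxne ((trivialization_snd_eq_zero_iff e hx _).2 (by rw [h0 x hxS]; rfl))

/-- A holomorphic frame of a holomorphic vector bundle which splits as a sum of subbundles can be
found locally from frames of the summands. -/
theorem exists_isLocalFrameOn_of_isInternal {ι : Type*} [Fintype ι] [DecidableEq ι]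
    (W : ι → Subbundle F E) (hW : ∀ x, DirectSum.IsInternal fun i => (W i).fiber x) (x₀ : X) :
    ∃ (U : Set X) (b : (Σ i, Fin (W i).rank) → ∀ x, E x), IsOpen U ∧ x₀ ∈ U ∧
      IsLocalFrameOn 𝓘(ℂ) F ω b U ∧ ∀ p, ∀ x ∈ U, b p x ∈ (W p.1).fiber x := by
  choose U hU hx₀ b hb hspan using fun i => (W i).exists_frame x₀
  have key : ∀ x ∈ ⋂ i, U i, ∃ v : Module.Basis (Σ i, Fin (W i).rank) ℂ (E x),
      ∀ p, v p = b p.1 p.2 x := by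
    intro x hx
    have hv : ∀ i, ∃ v : Module.Basis (Fin (W i).rank) ℂ ((W i).fiber x),
        ∀ j, (v j : E x) = b i j x := by
      intro i
      obtain ⟨hli, hsp⟩ := hspan i x (Set.mem_iInter.1 hx i)
      rw [← hsp]
      exact ⟨Module.Basis.span hli, fun j => congrArg _ (Module.Basis.span_apply hli j)⟩
    choose v hv using hv
    exact ⟨(hW x).collectedBasis v, fun p => by rw [(hW x).collectedBasis_coe v]; exact hv _ _⟩
  refine ⟨⋂ i, U i, fun p => b p.1 p.2, isOpen_iInter_of_finite hU, Set.mem_iInter.2 hx₀,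
    ⟨fun {x} hx => ?_, fun {x} hx => ?_, fun p => ?_⟩, fun p x hx => ?_⟩
  · obtain ⟨v, hv⟩ := key x hx
    simpa only [← hv] using v.linearIndependent
  · obtain ⟨v, hv⟩ := key x hx
    simpa only [← hv] using v.span_eq.ge
  · exact (hb p.1 p.2).mono (Set.iInter_subset _ _)
  · rw [← (hspan p.1 x (Set.mem_iInter.1 hx p.1)).2]
    exact Submodule.subset_span (Set.mem_range_self p.2)

/-- An endomorphism acting by a constant scalar on each summand of a holomorphic splitting is
holomorphic. -/
theorem isHolEnd_of_isInternal [FiniteDimensional ℂ F] [ContMDiffVectorBundle ω F E 𝓘(ℂ)]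
    {ι : Type*} [Fintype ι] [DecidableEq ι]
    (W : ι → Subbundle F E) (hW : ∀ x, DirectSum.IsInternal fun i => (W i).fiber x)
    (a : ι → ℂ) (D : ∀ x, E x →ₗ[ℂ] E x) (hD : ∀ x i, ∀ v ∈ (W i).fiber x, D x v = a i • v) :
    IsHolEnd F E D := by
  intro U t hU ht x₀ hx₀
  obtain ⟨V, b, hV, hx₀V, hb, hbW⟩ := exists_isLocalFrameOn_of_isInternal W hW x₀
  have hb' := hb.mono (Set.inter_subset_right (s := U))
  have hopen := hU.inter hV
  have hcoeff := fun p => hb'.contMDiffOn_coeff hopen (ht.mono Set.inter_subset_left) p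
  -- In the adapted frame `D` is diagonal with constant entries: it multiplies the `p`-th
  -- coefficient by `a p.1`.
  have hsum : ContMDiffOn 𝓘(ℂ) (𝓘(ℂ).prod 𝓘(ℂ, F)) ω
      (fun x => TotalSpace.mk' F x (∑ p, hb'.coeff p x (t x) • a p.1 • b p x)) (U ∩ V) :=
    ContMDiffOn.sum_section fun p _ => (hcoeff p).smul_section
      ((hb'.contMDiffOn p).const_smul_section (a := a p.1))
  have hmem := hopen.mem_nhds ⟨hx₀, hx₀V⟩
  refine ((hsum.contMDiffAt hmem).congr_of_eventuallyEq ?_).contMDiffWithinAt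
  filter_upwards [hmem] with x hx
  congr 1
  conv_lhs => rw [hb'.coeff_sum_eq t hx]
  rw [map_sum]
  exact Finset.sum_congr rfl fun p _ => by rw [map_smul, hD x p.1 _ (hbW p x hx.2)]

end Holomorphic

/-! ### Linear algebra in a single fibre -/

section LinearAlgebra

/-- There is an endomorphism acting by prescribed scalars on the summands of a direct sum. -/
theorem exists_linearMap_smul_of_isInternal {K V ι : Type*} [Field K] [AddCommGroup V] [Module K V]
    [DecidableEq ι] {W : ι → Submodule K V} (hW : DirectSum.IsInternal W) (a : ι → K) :
    ∃ D : V →ₗ[K] V, ∀ i, ∀ v ∈ W i, D v = a i • v := by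
  let Φ := LinearEquiv.ofBijective (DirectSum.coeLinearMap W) hW
  refine ⟨DirectSum.toModule K ι V (fun i => a i • (W i).subtype) ∘ₗ Φ.symm.toLinearMap,
    fun i v hv => ?_⟩
  have h : Φ.symm v = DirectSum.lof K ι (fun i => W i) i ⟨v, hv⟩ := by
    rw [LinearEquiv.symm_apply_eq]
    exact (DirectSum.coeLinearMap_lof W i ⟨v, hv⟩).symm
  rw [LinearMap.comp_apply, LinearEquiv.coe_coe, h, DirectSum.toModule_lof]
  rfl

/-- Contracting with a functional `f` such that `f l ≠ 0` recovers `f l • v` from `v ⊗ l`. -/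
theorem tmul_left_injective_of_ne_zero {K V L : Type*} [Field K] [AddCommGroup V] [Module K V]
    [AddCommGroup L] [Module K L] {l : L} (hl : l ≠ 0) :
    Function.Injective fun v : V => v ⊗ₜ[K] l := by
  obtain ⟨f, hf⟩ := Module.Projective.exists_dual_ne_zero K hl
  intro v w h
  have := congrArg (fun z => TensorProduct.rid K V (LinearMap.lTensor V f z)) h
  simp only [LinearMap.lTensor_tmul, TensorProduct.rid_tmul] at this
  exact smul_right_injective V hf this

/-- An endomorphism which strictly lowers a direct sum decomposition and commutes with an operator
acting by distinct scalars on the summands is zero. -/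
theorem eq_zero_of_commute_of_lowering {K V ι : Type*} [Field K] [AddCommGroup V] [Module K V]
    [DecidableEq ι] [Preorder ι] {W : ι → Submodule K V} (hW : DirectSum.IsInternal W) {a : ι → K}
    (ha : Function.Injective a) {D ψ : V →ₗ[K] V} (hD : ∀ i, ∀ v ∈ W i, D v = a i • v)
    (hcomm : ∀ v, ψ (D v) = D (ψ v))
    (hlow : ∀ i, ∀ v ∈ W i, ψ v ∈ ⨆ (j : ι) (_ : j < i), W j) : ψ = 0 := by
  have hle : ∀ i, W i ≤ LinearMap.ker ψ := by
    intro i v hv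
    have h1 : ψ v ∈ Module.End.eigenspace D (a i) := by
      rw [Module.End.mem_eigenspace_iff, ← hcomm, hD i v hv, map_smul]
    -- Injectivity of `a` puts each `W j` with `j < i` in an eigenspace for an eigenvalue other than
    -- `a i`.
    have h2 : ψ v ∈ ⨆ (c : K) (_ : c ≠ a i), Module.End.eigenspace D c := by
      refine (iSup₂_le fun j hj => ?_ :
        (⨆ (j : ι) (_ : j < i), W j) ≤ _) (hlow i v hv)
      exact le_trans (fun w hw => Module.End.mem_eigenspace_iff.2 (hD j w hw))
        (le_iSup₂_of_le (a j) (ha.ne hj.ne) le_rfl)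
    exact (Submodule.mem_bot K).1
      ((Module.End.eigenspaces_iSupIndep D (a i)).le_bot ⟨h1, h2⟩)
  refine LinearMap.ker_eq_top.1 (top_le_iff.1 ?_)
  rw [← hW.submodule_iSup_eq_top]
  exact iSup_le hle

end LinearAlgebra

/-! ### Higgs fields of the form `D ⊗ σ` -/

section Higgs

set_option linter.unusedSectionVars false

variable {X : Type*} [TopologicalSpace X] [ChartedSpace ℂ X]
  {F : Type*} [NormedAddCommGroup F] [NormedSpace ℂ F]
  {E : X → Type*} [TopologicalSpace (TotalSpace F E)]
  [∀ x, AddCommGroup (E x)] [∀ x, Module ℂ (E x)] [∀ x, TopologicalSpace (E x)]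
  [FiberBundle F E] [VectorBundle ℂ F E]
  {L : X → Type*} [TopologicalSpace (TotalSpace ℂ L)]
  [∀ x, AddCommGroup (L x)] [∀ x, Module ℂ (L x)] [∀ x, TopologicalSpace (L x)]
  [FiberBundle ℂ L] [VectorBundle ℂ ℂ L]

/-- The Higgs field `D ⊗ σ` of a holomorphic endomorphism `D` and a holomorphic section `σ`. -/
def HiggsField.ofEnd (D : ∀ x, E x →ₗ[ℂ] E x) (hD : IsHolEnd F E D) (σ : ∀ x, L x)
    (hσ : IsHolOn ℂ σ Set.univ) : HiggsField F E L where
  toFun x := (TensorProduct.mk ℂ (E x) (L x)).flip (σ x) ∘ₗ D x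
  holomorphic U t hU ht x₀ hx₀ := ⟨U, subset_rfl, hU, hx₀, 1, fun _ x => D x (t x), fun _ => σ,
    fun _ => hD U t hU ht, fun _ => hσ.mono (Set.subset_univ U), fun x _ => by simp⟩

theorem HiggsField.ofEnd_apply (D : ∀ x, E x →ₗ[ℂ] E x) (hD : IsHolEnd F E D) (σ : ∀ x, L x)
    (hσ : IsHolOn ℂ σ Set.univ) (x : X) (v : E x) :
    (HiggsField.ofEnd D hD σ hσ).toFun x v = D x v ⊗ₜ[ℂ] σ x := rfl

theorem HiggsField.ofEnd_isInvariant {D : ∀ x, E x →ₗ[ℂ] E x} {hD : IsHolEnd F E D} {σ : ∀ x, L x}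
    {hσ : IsHolOn ℂ σ Set.univ} {C : Subbundle F E}
    (hC : ∀ x, ∀ v ∈ C.fiber x, D x v ∈ C.fiber x) :
    (HiggsField.ofEnd D hD σ hσ).IsInvariant C :=
  fun x v hv => ⟨⟨D x v, hC x v hv⟩ ⊗ₜ[ℂ] σ x, rfl⟩

/-- Compatibility with `φ` reads `ψ (D v) ⊗ σ x = D (ψ v) ⊗ σ x`, and a nonzero `σ x` cancels. -/
theorem HiggsField.comm_of_mem_endomorphisms_ofEnd {D : ∀ x, E x →ₗ[ℂ] E x} {hD : IsHolEnd F E D}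
    {σ : ∀ x, L x} {hσ : IsHolOn ℂ σ Set.univ} {ψ : ∀ x, E x →ₗ[ℂ] E x}
    (hψ : ψ ∈ (HiggsField.ofEnd D hD σ hσ).endomorphisms) {x : X} (hx : σ x ≠ 0) (v : E x) :
    ψ x (D x v) = D x (ψ x v) :=
  tmul_left_injective_of_ne_zero hx (LinearMap.congr_fun (hψ.2 x) v)

/-- A Harder-Narasimhan filtration of the underlying bundle that is invariant under a Higgs field
is the Harder-Narasimhan filtration of the Higgs bundle. -/
theorem Subbundle.IsHNFiltration.toHiggs [FiniteDimensional ℂ F] [ContMDiffVectorBundle ω F E 𝓘(ℂ)]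
    {s : ℕ} {Fil : Fin (s + 1) → Subbundle F E} (h : Subbundle.IsHNFiltration Fil)
    {φ : HiggsField F E L} (hφ : ∀ i, φ.IsInvariant (Fil i)) : φ.IsHNFiltration Fil where
  first := h.first
  last := h.last
  le := h.le
  rank_lt := h.rank_lt
  invariant := hφ
  semistable i C hA hB hr _ := h.semistable i C hA hB hr
  slope_lt := h.slope_lt

end Higgs

end HiggsBundle

theorem mainTheorem11
    {X : Type*} [TopologicalSpace X] [ChartedSpace ℂ X] [IsManifold 𝓘(ℂ) ω X]
    [CompactSpace X] [T2Space X] [ConnectedSpace X]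
    {F : Type*} [NormedAddCommGroup F] [NormedSpace ℂ F] [FiniteDimensional ℂ F]
    {E : X → Type*} [TopologicalSpace (TotalSpace F E)]
    [∀ x, AddCommGroup (E x)] [∀ x, Module ℂ (E x)] [∀ x, TopologicalSpace (E x)]
    [FiberBundle F E] [VectorBundle ℂ F E] [ContMDiffVectorBundle ω F E 𝓘(ℂ)]
    {L : X → Type*} [TopologicalSpace (TotalSpace ℂ L)]
    [∀ x, AddCommGroup (L x)] [∀ x, Module ℂ (L x)] [∀ x, TopologicalSpace (L x)]
    [FiberBundle ℂ L] [VectorBundle ℂ ℂ L] [ContMDiffVectorBundle ω ℂ L 𝓘(ℂ)]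
    -- `h⁰(L) ≠ 0`
    (hL : ∃ σ : ∀ x, L x, HiggsBundle.IsHolOn ℂ σ Set.univ ∧ σ ≠ 0)
    -- the Harder-Narasimhan filtration of `E`, its type `μ ≠ μ₀`
    {s : ℕ} (Fil : Fin (s + 1) → HiggsBundle.Subbundle F E)
    (hFil : HiggsBundle.Subbundle.IsHNFiltration Fil)
    (μ : List ℚ) (hμ : HiggsBundle.Subbundle.filtrationType Fil = μ)
    (hμ₀ : μ ≠ HiggsBundle.Subbundle.semistableType F E)
    -- `E = E₁ ⊕ ⋯ ⊕ Eₛ` splits its Harder-Narasimhan filtration: `Eᵏ = E₁ ⊕ ⋯ ⊕ Eₖ`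
    (W : Fin s → HiggsBundle.Subbundle F E)
    (hW : ∀ x, DirectSum.IsInternal fun i => (W i).fiber x)
    (hWFil : ∀ (k : Fin (s + 1)) (x : X),
      (Fil k).fiber x = ⨆ (j : Fin s) (_ : j.castSucc < k), (W j).fiber x) :
    ∃ (σ : Fin s → ∀ x, L x) (φ : HiggsBundle.HiggsField F E L),
      -- the `σᵢ` are pairwise distinct holomorphic sections of `L` and `φ = σ₁ ⊕ ⋯ ⊕ σₛ`
      (∀ i, HiggsBundle.IsHolOn ℂ (σ i) Set.univ) ∧ Function.Injective σ ∧
      (∀ i x, ∀ v ∈ (W i).fiber x, φ.toFun x v = v ⊗ₜ[ℂ] σ i x) ∧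
      -- the Higgs bundle `(E, φ)` has Higgs Harder-Narasimhan type `μ`, with the same filtration
      φ.IsHNFiltration Fil ∧
      φ.endNegOne Fil = ⊥ := by
  obtain ⟨σ, hσ, hσ0⟩ := hL
  -- The scalars are `0, …, s - 1`; the first section is then zero, which is harmless because only
  -- distinctness matters.
  have hinj : Function.Injective fun i : Fin s => ((i : ℕ) : ℂ) :=
    Nat.cast_injective.comp Fin.val_injective
  -- `D` is chosen fibre by fibre, but its values on the summands determine it, so holomorphy can be
  -- proved afterwards.
  choose D hD using fun x => HiggsBundle.exists_linearMap_smul_of_isInternal (hW x)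
    (fun i : Fin s => ((i : ℕ) : ℂ))
  have hDhol : HiggsBundle.IsHolEnd F E D :=
    HiggsBundle.isHolEnd_of_isInternal W hW (fun i : Fin s => ((i : ℕ) : ℂ)) D hD
  refine ⟨fun i x => ((i : ℕ) : ℂ) • σ x, HiggsBundle.HiggsField.ofEnd D hDhol σ hσ,
    fun i => hσ.const_smul_section, fun i j hij => ?_, fun i x v hv => ?_,
    hFil.toHiggs fun k => HiggsBundle.HiggsField.ofEnd_isInvariant fun x v hv => ?_, ?_⟩
  · exact hinj (smul_left_injective ℂ hσ0 hij)
  · rw [HiggsBundle.HiggsField.ofEnd_apply, hD x i v hv, TensorProduct.smul_tmul]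
  -- Invariance of `Eᵏ` under `D` is checked on the summands that span it.
  · have hle : (Fil k).fiber x ≤ ((Fil k).fiber x).comap (D x) := by
      conv_lhs => rw [hWFil]
      refine iSup₂_le fun j hj w hw => ?_
      rw [Submodule.mem_comap, hD x j w hw, hWFil]
      exact Submodule.smul_mem _ _ (le_iSup₂_of_le (f := fun (j : Fin s) (_ : j.castSucc < k) =>
        (W j).fiber x) j hj le_rfl hw)
    exact hle hv
  · refine (Submodule.eq_bot_iff _).2 fun ψ hψ =>
      hψ.1.1.eq_zero_of_dense (hσ.dense_setOf_ne_zero hσ0) fun x hx => ?_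
    refine HiggsBundle.eq_zero_of_commute_of_lowering (hW x) hinj (hD x)
      (HiggsBundle.HiggsField.comm_of_mem_endomorphisms_ofEnd hψ.1 hx) fun i v hv => ?_
    have hmem : v ∈ (Fil i.succ).fiber x := by
      rw [hWFil]
      exact le_iSup₂_of_le (f := fun (j : Fin s) (_ : j.castSucc < i.succ) => (W j).fiber x)
        i Fin.castSucc_lt_succ le_rfl hv
    -- `W i` lies in the step `i.succ`, and the step `i.castSucc` is the sum of the `W j` with `j <
    -- i`, as the lowering hypothesis requires.
    have h := hψ.2 i x v hmem
    rw [hWFil] at h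
    simpa only [Fin.castSucc_lt_castSucc_iff] using h
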